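/- **Setting.** Let $X$ be a closed subset of a separable real Banach space with the induced metric $d_X$, $Y$ a complete separable metric space, and $\mathcal H$ a separable real Hilbert space. Let $F\colon X\rightsquigarrow Y$ be a set-valued map with non-empty images and closed graph $Z=\{(x,y)\in X\times Y : y\in F(x)\}$, and write $Z_x=F(x)$. Let $g\colon Z\to\mathcal H$ and $f\colon\mathcal H\to\mathbb R$. Let $\mathcal P^1(X)$ be the set of Borel probability measures $m$ on $X$ with $\int_X d_X(x,x_0)\,dm(x)<\infty$ for some $x_0\in X$. For a Borel probability measure $m$ on $X$, let $\mathcal P_m(Z)$ be the set of Borel probability measures on $Z$ whose marginal on $X$ is $m$, and put $$G_m=\Big\{\int_Z g\,d\mu : \mu\in\mathcal P_m(Z)\Big\},\qquad V(m)=\inf_{\mu\in\mathcal P_m(Z)} f\Big(\int_Z g\,d\mu\Big).$$ For $\lambda\in\mathcal H$ put $g_\lambda=\langle\lambda,g\rangle$ and $u_\lambda(x)=\inf_{y\in Z_x} g_\lambda(x,y)$. Let $f^*(\lambda)=\sup_{\beta\in\mathcal H}\big(\langle\lambda,\beta\rangle-f(\beta)\big)$ and $\operatorname{dom}(f^*)=\{\lambda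 : f^*(\lambda)<+\infty\}$. **Assumptions.** 1. $g$ is bounded; $f$ is convex and differentiable, and $\nabla f$ is Lipschitz continuous. 2. For every $\lambda\in\operatorname{dom}(f^*)$: $g_\lambda$ is lower semicontinuous on $Z$; the set-valued map $x\mapsto\{g_\lambda(x,y) : y\in Z_x\}$ is lower semicontinuous; and $\operatorname{argmin}_{y\in Z_x} g_\lambda(x,y)\neq\emptyset$ for every $x\in X$. 3. $g$ is continuous; $Z_x$ is compact for every $x\in X$, and $F$ is upper semicontinuous. 4. There is $L_g\ge 0$ such that for all $x_1,x_2\in X$ and $y_1\in Z_{x_1}$ there is $y_2\in Z_{x_2}$ with $\|g(x_1,y_1)-g(x_2,y_2)\|\le L_g\, d_X(x_1,x_2)$. 5. $G_m$ is closed in $\mathcal H$ for every $m\in\mathcal P^1(X)$. **Conclusion.** For every $m\in\mathcal P^1(X)$, the infimum $V(m)$ is finite (taken over a non-empty set of costs that is bounded below), and the dual objective $\mathcal D_m(\lambda)=f^*(\lambda)-\int_X u_\lambda\,dm$ has a unique minimizer $\lambda^*(m)$ over $\operatorname{dom}(f^*)$. Put $v(m,x)=u_{\lambda^*(m)}(x)$;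 for every $m\in\mathcal P^1(X)$, the function $v(m,\cdot)$ is integrable with respect to every measure in $\mathcal P^1(X)$. For all $m_0,m_1\in\mathcal P^1(X)$, $$\lim_{t\to0^+}\frac{V(m_0+t(m_1-m_0))-V(m_0)}{t}=\int_X v(m_0,x)\,d(m_1-m_0)(x).$$ Moreover, $t\mapsto\int_X v(m_0+t(m_1-m_0),x)\,d(m_1-m_0)(x)$ is integrable on $[0,1]$, and $$V(m_1)-V(m_0)=\int_0^1\int_X v(m_0+t(m_1-m_0),x)\,d(m_1-m_0)(x)\,dt.$$ -/

import Mathlib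

open MeasureTheory Filter Topology
open scoped NNReal ENNReal Pointwise

namespace MFO

noncomputable section

variable {X Y H : Type*}

/-- The graph `Z` of a set-valued map `F : X ⇝ Y`; its fibre over `x` is `Z_x = F x`. -/
abbrev Graph (F : X → Set Y) : Set (X × Y) := {p | p.2 ∈ F p.1}

/-- The point `(x, y)` of the graph. -/
abbrev Graph.mk {F : X → Set Y} (x : X) (y : Y) (hy : y ∈ F x) : Graph F := ⟨(x, y), hy⟩

section Measures

variable [MeasurableSpace X] [MeasurableSpace Y]

/-- Borel probability measures on `X` with finite first moment. -/
def P1 (X : Type*) [MetricSpace X] [MeasurableSpace X] : Set (Measure X) :=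
  {m | IsProbabilityMeasure m ∧ ∃ x₀ : X, ∫⁻ x, edist x x₀ ∂m < ∞}

/-- `m₀ + t (m₁ - m₀)`, written as `(1 - t) m₀ + t m₁`; only used for `t ∈ [0, 1]`. -/
def segment (m₀ m₁ : Measure X) (t : ℝ) : Measure X :=
  ENNReal.ofReal (1 - t) • m₀ + ENNReal.ofReal t • m₁

/-- `∫ φ d(m₁ - m₀)`. -/
def integralDiff (φ : X → ℝ) (m₀ m₁ : Measure X) : ℝ :=
  ∫ x, φ x ∂m₁ - ∫ x, φ x ∂m₀

/-- `𝒫_m(Z)`: the probability measures on `Z` whose first marginal is `m`. -/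
def admissible (F : X → Set Y) (m : Measure X) : Set (Measure (Graph F)) :=
  {μ | IsProbabilityMeasure μ ∧ μ.map (fun z : Graph F => z.1.1) = m}

variable [NormedAddCommGroup H] [InnerProductSpace ℝ H]

/-- `G_m`: all the aggregates `∫_Z g dμ`, `μ ∈ 𝒫_m(Z)`. -/
def aggregates {F : X → Set Y} (g : Graph F → H) (m : Measure X) : Set H :=
  (fun μ : Measure (Graph F) => ∫ z, g z ∂μ) '' admissible F m

/-- All the costs `f (∫_Z g dμ)`, `μ ∈ 𝒫_m(Z)`. -/
def costs {F : X → Set Y} (f : H → ℝ) (g : Graph F → H) (m : Measure X) : Set ℝ :=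
  (fun μ : Measure (Graph F) => f (∫ z, g z ∂μ)) '' admissible F m

/-- The value function `V(m) = inf_{μ ∈ 𝒫_m(Z)} f (∫_Z g dμ)`. -/
def V {F : X → Set Y} (f : H → ℝ) (g : Graph F → H) (m : Measure X) : ℝ :=
  sInf (costs f g m)

end Measures

variable [NormedAddCommGroup H] [InnerProductSpace ℝ H]

/-- `g_λ(x, y) = ⟨λ, g(x, y)⟩`. -/
def gLam {F : X → Set Y} (g : Graph F → H) (lam : H) (z : Graph F) : ℝ :=
  inner ℝ lam (g z)

/-- `u_λ(x) = inf_{y ∈ Z_x} g_λ(x, y)`. -/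
def u {F : X → Set Y} (g : Graph F → H) (lam : H) (x : X) : ℝ :=
  ⨅ y : F x, gLam g lam (Graph.mk x y.1 y.2)

/-- `G_λ(x) = {g_λ(x, y) : y ∈ Z_x}`. -/
def GLam {F : X → Set Y} (g : Graph F → H) (lam : H) (x : X) : Set ℝ :=
  Set.range fun y : F x => gLam g lam (Graph.mk x y.1 y.2)

/-- `BR_λ(x) = argmin_{y ∈ Z_x} g_λ(x, y)`. -/
def BR {F : X → Set Y} (g : Graph F → H) (lam : H) (x : X) : Set Y :=
  {y | ∃ hy : y ∈ F x, ∀ (y' : Y) (hy' : y' ∈ F x),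
    gLam g lam (Graph.mk x y hy) ≤ gLam g lam (Graph.mk x y' hy')}

/-- `x ↦ {g(x, y) : y ∈ Z_x}`. -/
def gImage {F : X → Set Y} (g : Graph F → H) (x : X) : Set H :=
  Set.range fun y : F x => g (Graph.mk x y.1 y.2)

/-- The set-valued map `S` is `K`-Lipschitz: `S x₁ ⊆ S x₂ + B(0, K d(x₁, x₂))` (closed balls). -/
def LipschitzSetValued [MetricSpace X] (K : ℝ≥0) (S : X → Set H) : Prop :=
  ∀ x₁ x₂ : X, S x₁ ⊆ S x₂ + Metric.closedBall (0 : H) (K * dist x₁ x₂)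

/-- The Fenchel conjugate `f*(λ) = sup_β (⟨λ, β⟩ - f(β))`. -/
def fenchelConj (f : H → ℝ) (lam : H) : EReal :=
  ⨆ β : H, ((inner ℝ lam β - f β : ℝ) : EReal)

/-- The domain of the Fenchel conjugate. -/
def domConj (f : H → ℝ) : Set H := {lam | fenchelConj f lam < ⊤}

/-- The dual objective `𝒟_m(λ) = f*(λ) - ∫ u_λ dm`. -/
def dualObj [MeasurableSpace X] {F : X → Set Y} (f : H → ℝ) (g : Graph F → H) (m : Measure X)
    (lam : H) : EReal :=
  fenchelConj f lam - ((∫ x, u g lam x ∂m : ℝ) : EReal)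

/-- `λ` minimizes `𝒟_m` over `dom f*`. -/
def IsDualSolution [MeasurableSpace X] {F : X → Set Y} (f : H → ℝ) (g : Graph F → H)
    (m : Measure X) (lam : H) : Prop :=
  lam ∈ domConj f ∧ IsMinOn (dualObj f g m) (domConj f) lam

/-- `λ*(m)`, the dual solution. -/
def dualSolution [MeasurableSpace X] {F : X → Set Y} (f : H → ℝ) (g : Graph F → H)
    (m : Measure X) : H :=
  Classical.epsilon (IsDualSolution f g m)

/-- `v(m, x) = u_{λ*(m)}(x)`. -/
def v [MeasurableSpace X] {F : X → Set Y} (f : H → ℝ) (g : Graph F → H)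
    (m : Measure X) (x : X) : ℝ :=
  u g (dualSolution f g m) x

/-- The assumptions on `f` and `g` under which the dual problem is considered. -/
structure DualityAssumption [TopologicalSpace X] [TopologicalSpace Y] [CompleteSpace H]
    {F : X → Set Y} (f : H → ℝ) (g : Graph F → H) (L : ℝ≥0) : Prop where
  bounded_g : ∃ M : ℝ, ∀ z, ‖g z‖ ≤ M
  convex_f : ConvexOn ℝ Set.univ f
  differentiable_f : Differentiable ℝ f
  lipschitz_gradient : LipschitzWith L (gradient f)
  lsc_gLam : ∀ lam ∈ domConj f, LowerSemicontinuous (gLam g lam)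
  lsc_GLam : ∀ lam ∈ domConj f, LowerHemicontinuous (GLam g lam)
  nonempty_BR : ∀ lam ∈ domConj f, ∀ x, (BR g lam x).Nonempty

/-- The regularity assumptions on `F` and `g` used for the stability with respect to `m`. -/
structure StabilityAssumption [MetricSpace X] [TopologicalSpace Y]
    (F : X → Set Y) (g : Graph F → H) (Lg : ℝ≥0) : Prop where
  continuous_g : Continuous g
  compact_fibres : ∀ x, IsCompact (F x)
  usc_F : UpperHemicontinuous F
  lipschitz_gImage : LipschitzSetValued Lg (gImage g)

end

end MFO

/-!
The linearized problem `min ⟨λ, ∫ g dμ⟩` over `𝒫_m(Z)` is solved fibrewise: its value is `∫ u_λ dm`,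
attained by a measurable selection of the minimizers of `g_λ` over the fibres `Z_x`. As `G_m` is
convex, bounded and closed, `f` attains its minimum over it at some `β`, and the first-order
condition reads `∫ u_λ dm = ⟨λ, β⟩` with `λ = ∇f(β)`. Fenchel's inequality then makes `∇f(β)` the
only minimizer of `𝒟_m`, and `m' ↦ V(m) + ∫ v(m, ·) d(m' - m)` is an affine minorant of `V` that
touches it at `m`. So along a segment `m_t` of measures `V` is a convex function of `t` with
subgradient `p(t) = ∫ v(m_t, ·) d(m₁ - m₀)`. Since `∇f` is Lipschitz, `f` exceeds its tangent at `β`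
by at least a multiple of `‖∇f - ∇f(β)‖²`; adding this estimate for two points of the segment shows
that `λ*(m_t)` and `p` are Lipschitz in `t`, and a convex function with a continuous selection of
subgradients is continuously differentiable.
-/

namespace MFO

section ConvexAnalysis

variable {H : Type*} [NormedAddCommGroup H] [InnerProductSpace ℝ H] {f : H → ℝ}

theorem le_fenchelConj (f : H → ℝ) (lam β : H) :
    ((inner ℝ lam β - f β : ℝ) : EReal) ≤ fenchelConj f lam :=
  le_iSup (fun β : H => ((inner ℝ lam β - f β : ℝ) : EReal)) β

variable [CompleteSpace H]

theorem add_inner_sub_le_of_hasGradientAt (hc : ConvexOn ℝ Set.univ f) {x ξ : H}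
    (hξ : HasGradientAt f ξ x) (y : H) : f x + inner ℝ ξ (y - x) ≤ f y := by
  have hline : ConvexOn ℝ Set.univ (f ∘ AffineMap.lineMap x y) := hc.comp_affineMap _
  have hderiv : HasDerivAt (f ∘ AffineMap.lineMap x y) (inner ℝ ξ (y - x)) (0 : ℝ) := by
    have hfx : HasFDerivAt f (InnerProductSpace.toDual ℝ H ξ) (AffineMap.lineMap x y (0 : ℝ)) := by
      simpa using hξ.hasFDerivAt
    exact hfx.comp_hasDerivAt 0 AffineMap.hasDerivAt_lineMap
  have hslope := hline.le_slope_of_hasDerivAt (Set.mem_univ 0) (Set.mem_univ 1) zero_lt_one hderiv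
  simp only [slope_def_field, Function.comp_apply, AffineMap.lineMap_apply_one,
    AffineMap.lineMap_apply_zero, sub_zero, div_one] at hslope
  linarith

theorem eq_of_forall_add_inner_sub_le {x ξ lam : H} (hξ : HasGradientAt f ξ x)
    (hlam : ∀ y, f x + inner ℝ lam (y - x) ≤ f y) : lam = ξ := by
  have hmin : IsLocalMin (fun y => f y - inner ℝ lam y) x := .of_forall fun y => by
    have := hlam y
    rw [inner_sub_right] at this
    linarith
  have hzero := hmin.hasFDerivAt_eq_zero (hξ.hasFDerivAt.sub (innerSL ℝ lam).hasFDerivAt)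
  exact ((InnerProductSpace.toDual ℝ H).injective (sub_eq_zero.1 hzero)).symm

theorem inner_sub_nonneg_of_isMinOn {s : Set H} (hs : Convex ℝ s) {x y ξ : H}
    (hmin : IsMinOn f s x) (hξ : HasGradientAt f ξ x) (hx : x ∈ s) (hy : y ∈ s) :
    0 ≤ inner ℝ ξ (y - x) :=
  hmin.localize.hasFDerivWithinAt_nonneg hξ.hasFDerivAt.hasFDerivWithinAt
    (sub_mem_posTangentConeAt_of_segment_subset (hs.segment_subset hx hy))

theorem norm_sq_gradient_sub_le (hc : ConvexOn ℝ Set.univ f) (hf : Differentiable ℝ f) {L : ℝ≥0}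
    (hL : LipschitzWith L (gradient f)) (x y : H) :
    ‖gradient f y - gradient f x‖ ^ 2
      ≤ 4 * L * (f y - f x - inner ℝ (gradient f x) (y - x)) := by
  set w : H := gradient f y - gradient f x with hw
  rcases eq_zero_or_pos L with rfl | hLpos
  · have : ‖w‖ ≤ 0 := by simpa using hL.norm_sub_le y x
    simp [this.antisymm (norm_nonneg w)]
  -- A gradient step from `y` along `w` of length `1 / (2L)`, half the classical step: the
  -- descent lemma is then not needed, at the price of the constant `4L` instead of `2L`.
  have hL0 : (0 : ℝ) < L := hLpos
  set r : ℝ := (2 * L)⁻¹ with hr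
  set z : H := y - r • w with hz
  have hyz : y - z = r • w := by rw [hz]; abel
  have hzx : z - x = (y - x) - r • w := by rw [hz]; abel
  have hnorm : ‖y - z‖ = r * ‖w‖ := by rw [hyz, norm_smul, Real.norm_of_nonneg (by positivity)]
  have hxz := add_inner_sub_le_of_hasGradientAt hc (hf x).hasGradientAt z
  have hzy := add_inner_sub_le_of_hasGradientAt hc (hf z).hasGradientAt y
  have hlip : inner ℝ (gradient f y - gradient f z) (y - z) ≤ L * ‖y - z‖ * ‖y - z‖ :=
    (real_inner_le_norm _ _).trans
      (mul_le_mul_of_nonneg_right (hL.norm_sub_le y z) (norm_nonneg _))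
  rw [hzx, inner_sub_right, inner_smul_right] at hxz
  rw [hyz, inner_smul_right] at hzy
  rw [hnorm, hyz, inner_sub_left, inner_smul_right, inner_smul_right] at hlip
  have hinner : inner ℝ (gradient f y) w - inner ℝ (gradient f x) w = ‖w‖ ^ 2 := by
    rw [← inner_sub_left, ← hw, real_inner_self_eq_norm_sq]
  have hgain : r * ‖w‖ ^ 2 - L * (r * ‖w‖) * (r * ‖w‖)
      ≤ f y - f x - inner ℝ (gradient f x) (y - x) := by
    rw [← hinner]
    linarith
  calc ‖w‖ ^ 2 = 4 * L * (r * ‖w‖ ^ 2 - L * (r * ‖w‖) * (r * ‖w‖)) := by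
        rw [hr]; field_simp [hL0.ne']; ring
    _ ≤ _ := by gcongr

theorem isCompact_toWeakSpace_closedBall (r : ℝ) :
    IsCompact (toWeakSpace ℝ H '' Metric.closedBall 0 r) := by
  let toPrimal : WeakDual ℝ H → WeakSpace ℝ H := fun ℓ =>
    toWeakSpace ℝ H ((InnerProductSpace.toDual ℝ H).symm (WeakDual.toStrongDual ℓ))
  have heval (v : H) (ℓ : WeakDual ℝ H) :
      InnerProductSpace.toDual ℝ H v ((toWeakSpace ℝ H).symm (toPrimal ℓ)) = ℓ v := by
    rw [InnerProductSpace.toDual_apply_apply, real_inner_comm]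
    exact InnerProductSpace.toDual_symm_apply
  have hcont : Continuous toPrimal := WeakBilin.continuous_of_continuous_eval _ fun ℓ => by
    obtain ⟨v, rfl⟩ := (InnerProductSpace.toDual ℝ H).surjective ℓ
    exact (WeakDual.eval_continuous v).congr fun ℓ => (heval v ℓ).symm
  have himage : toWeakSpace ℝ H '' Metric.closedBall 0 r =
      toPrimal '' (WeakDual.toStrongDual ⁻¹' Metric.closedBall 0 r) := by
    refine Set.Subset.antisymm ?_ ?_
    · rintro _ ⟨x, hx, rfl⟩
      exact ⟨StrongDual.toWeakDual (InnerProductSpace.toDual ℝ H x), by simpa using hx,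
        by simp [toPrimal]⟩
    · rintro _ ⟨ℓ, hℓ, rfl⟩
      exact ⟨_, by simpa using hℓ, rfl⟩
  rw [himage]
  exact (WeakDual.isCompact_closedBall 0 r).image hcont

theorem exists_isMinOn_of_convexOn (hc : ConvexOn ℝ Set.univ f) (hf : LowerSemicontinuous f)
    {s : Set H} (hne : s.Nonempty) (hcl : IsClosed s) (hs : Convex ℝ s)
    (hbdd : Bornology.IsBounded s) : ∃ x ∈ s, IsMinOn f s x := by
  have hweak : ∀ {t : Set H}, IsClosed t → Convex ℝ t → IsClosed (toWeakSpace ℝ H '' t) :=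
    fun ht htc => by
      rw [← ht.closure_eq, htc.toWeakSpace_closure ℝ]
      exact isClosed_closure
  obtain ⟨r, hr⟩ := hbdd.subset_closedBall 0
  have hcomp : IsCompact (toWeakSpace ℝ H '' s) :=
    (isCompact_toWeakSpace_closedBall r).of_isClosed_subset (hweak hcl hs) (Set.image_mono hr)
  have hlsc : LowerSemicontinuous (f ∘ (toWeakSpace ℝ H).symm) :=
    lowerSemicontinuous_iff_isClosed_preimage.2 fun a => by
      rw [Set.preimage_comp, ← LinearEquiv.image_eq_preimage_symm]
      exact hweak (hf.isClosed_preimage a) (by simpa using! hc.convex_le a)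
  obtain ⟨_, ⟨x, hx, rfl⟩, hmin⟩ :=
    (hlsc.lowerSemicontinuousOn _).exists_isMinOn (hne.image _) hcomp
  exact ⟨x, hx, fun y hy => by simpa using hmin (Set.mem_image_of_mem _ hy)⟩

theorem fenchelConj_eq_of_hasGradientAt (hc : ConvexOn ℝ Set.univ f) {β ξ : H}
    (hξ : HasGradientAt f ξ β) : fenchelConj f ξ = ((inner ℝ ξ β - f β : ℝ) : EReal) := by
  refine (iSup_le fun y => EReal.coe_le_coe_iff.2 ?_).antisymm (le_fenchelConj f ξ β)
  have := add_inner_sub_le_of_hasGradientAt hc hξ y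
  rw [inner_sub_right] at this
  linarith

theorem mem_domConj_of_hasGradientAt (hc : ConvexOn ℝ Set.univ f) {β ξ : H}
    (hξ : HasGradientAt f ξ β) : ξ ∈ domConj f :=
  (fenchelConj_eq_of_hasGradientAt hc hξ).trans_lt (EReal.coe_lt_top _)

end ConvexAnalysis

section Selection

variable {X Y : Type*} [MeasurableSpace X]

/-- A set-valued map with non-empty closed values that is measurable in the strong sense: the
inverse images of closed sets (and not only those of open sets) are measurable. -/
structure MeasurableClosedValued [TopologicalSpace Y] (S : X → Set Y) : Prop where
  nonempty : ∀ x, (S x).Nonempty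
  isClosed : ∀ x, IsClosed (S x)
  measurableSet_inter : ∀ C, IsClosed C → MeasurableSet {x | (S x ∩ C).Nonempty}

theorem MeasurableClosedValued.exists_subset_closedBall [PseudoMetricSpace Y]
    [TopologicalSpace.SeparableSpace Y] [Nonempty Y] [MeasurableSpace Y] {S : X → Set Y}
    (hS : MeasurableClosedValued S) {ε : ℝ} (hε : 0 < ε) :
    ∃ (S' : X → Set Y) (c : X → Y), MeasurableClosedValued S' ∧ Measurable c ∧
      ∀ x, S' x ⊆ S x ∧ S' x ⊆ Metric.closedBall (c x) ε := by
  classical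
  let d := TopologicalSpace.denseSeq Y
  have hex : ∀ x, ∃ n, (S x ∩ Metric.closedBall (d n) ε).Nonempty := fun x => by
    obtain ⟨y, hy⟩ := hS.nonempty x
    obtain ⟨n, hn⟩ := (TopologicalSpace.denseRange_denseSeq Y).exists_dist_lt y hε
    exact ⟨n, y, hy, hn.le⟩
  let k : X → ℕ := fun x => Nat.find (hex x)
  have hk : Measurable k :=
    measurable_find hex fun n => hS.measurableSet_inter _ Metric.isClosed_closedBall
  refine ⟨fun x => S x ∩ Metric.closedBall (d (k x)) ε, fun x => d (k x),
    ⟨fun x => Nat.find_spec (hex x), fun x => (hS.isClosed x).inter Metric.isClosed_closedBall,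
      fun C hC => ?_⟩, measurable_from_nat.comp hk,
    fun x => ⟨Set.inter_subset_left, Set.inter_subset_right⟩⟩
  have hcover : {x | (S x ∩ Metric.closedBall (d (k x)) ε ∩ C).Nonempty} =
      ⋃ n, k ⁻¹' {n} ∩ {x | (S x ∩ (Metric.closedBall (d n) ε ∩ C)).Nonempty} := by
    ext x
    simp [Set.inter_assoc]
  rw [hcover]
  exact .iUnion fun n => (hk (measurableSet_singleton n)).inter
    (hS.measurableSet_inter _ (Metric.isClosed_closedBall.inter hC))

theorem MeasurableClosedValued.exists_antitone_subset_closedBall [PseudoMetricSpace Y]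
    [TopologicalSpace.SeparableSpace Y] [Nonempty Y] [MeasurableSpace Y] {S : X → Set Y}
    (hS : MeasurableClosedValued S) {ε : ℕ → ℝ} (hε : ∀ n, 0 < ε n) :
    ∃ (T : ℕ → X → Set Y) (c : ℕ → X → Y), (∀ n, MeasurableClosedValued (T n)) ∧ Antitone T ∧
      T 0 ≤ S ∧ (∀ n, Measurable (c n)) ∧ ∀ n x, T n x ⊆ Metric.closedBall (c n x) (ε n) := by
  have hstep (n : ℕ) (S' : {S' : X → Set Y // MeasurableClosedValued S'}) :
      ∃ (T : {T : X → Set Y // MeasurableClosedValued T}) (c : X → Y), Measurable c ∧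
        ∀ x, T.1 x ⊆ S'.1 x ∧ T.1 x ⊆ Metric.closedBall (c x) (ε n) := by
    obtain ⟨T, c, hT, hc, hTc⟩ := S'.2.exists_subset_closedBall (hε n)
    exact ⟨⟨T, hT⟩, c, hc, hTc⟩
  choose next c hc hnext using hstep
  let T : ℕ → {T : X → Set Y // MeasurableClosedValued T} := fun n => Nat.rec ⟨S, hS⟩ next n
  exact ⟨fun n => (T (n + 1)).1, fun n => c n (T n), fun n => (T (n + 1)).2,
    antitone_nat_of_succ_le fun n x => (hnext (n + 1) (T (n + 1)) x).1,
    fun x => (hnext 0 (T 0) x).1, fun n => hc n (T n), fun n x => (hnext n (T n) x).2⟩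

/-- The Kuratowski–Ryll-Nardzewski selection theorem. -/
theorem MeasurableClosedValued.exists_measurable_selection [TopologicalSpace Y] [PolishSpace Y]
    [MeasurableSpace Y] [BorelSpace Y] {S : X → Set Y} (hS : MeasurableClosedValued S) :
    ∃ s : X → Y, Measurable s ∧ ∀ x, s x ∈ S x := by
  let := TopologicalSpace.upgradeIsCompletelyMetrizable Y
  rcases isEmpty_or_nonempty X with _ | ⟨⟨x₀⟩⟩
  · exact ⟨fun x => isEmptyElim x, measurable_of_empty _, fun x => isEmptyElim x⟩
  have : Nonempty Y := (hS.nonempty x₀).to_type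
  have hpow : Tendsto (fun n : ℕ => (1 / 2 : ℝ) ^ n) atTop (𝓝 0) :=
    tendsto_pow_atTop_nhds_zero_of_lt_one (by norm_num) (by norm_num)
  obtain ⟨T, c, hT, hanti, hTS, hc, hball⟩ :=
    hS.exists_antitone_subset_closedBall (ε := fun n => (1 / 2 : ℝ) ^ n) fun n => by positivity
  have hcantor (x : X) : (⋂ n, T n x).Nonempty := by
    refine Metric.nonempty_iInter_of_nonempty_biInter (fun n => (hT n).isClosed x)
      (fun n => Metric.isBounded_closedBall.subset (hball n x)) (fun N => ?_) ?_
    · obtain ⟨y, hy⟩ := (hT N).nonempty x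
      exact ⟨y, Set.mem_iInter₂.2 fun n hn => hanti hn x hy⟩
    · refine squeeze_zero (fun n => Metric.diam_nonneg) (fun n => ?_)
        (mul_zero (2 : ℝ) ▸ hpow.const_mul 2)
      exact (Metric.diam_mono (hball n x) Metric.isBounded_closedBall).trans
        (Metric.diam_closedBall (pow_nonneg one_half_pos.le n))
  choose s hs using hcantor
  have hsT (x : X) (n : ℕ) : s x ∈ T n x := Set.mem_iInter.1 (hs x) n
  refine ⟨s, measurable_of_tendsto_metrizable hc (tendsto_pi_nhds.2 fun x => ?_),
    fun x => hTS x (hsT x 0)⟩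
  refine tendsto_iff_dist_tendsto_zero.2 (squeeze_zero (fun _ => dist_nonneg) (fun n => ?_) hpow)
  rw [dist_comm]
  exact hball n x (hsT x n)

end Selection

section FibreInf

variable {X Y : Type*} {F : X → Set Y} {φ ψ : Graph F → ℝ}

/-- The infimum of a function on the graph of `F` over the fibre above `x`, so that `u_λ` is the
case `φ = g_λ`. It has the junk value `0` when `φ` is not bounded below on the fibre. -/
noncomputable def fibreInf (φ : Graph F → ℝ) (x : X) : ℝ := ⨅ y : F x, φ (Graph.mk x y.1 y.2)

theorem fibreInf_le {z : Graph F}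
    (hφ : BddBelow (Set.range fun y : F z.1.1 => φ (Graph.mk z.1.1 y.1 y.2))) :
    fibreInf φ z.1.1 ≤ φ z :=
  ciInf_le hφ ⟨z.1.2, z.2⟩

theorem fibreInf_le_of_bddBelow (hφ : BddBelow (Set.range φ)) (z : Graph F) :
    fibreInf φ z.1.1 ≤ φ z :=
  fibreInf_le (hφ.mono (Set.range_comp_subset_range _ φ))

theorem le_fibreInf {x : X} (hne : (F x).Nonempty) {a : ℝ}
    (h : ∀ y (hy : y ∈ F x), a ≤ φ (Graph.mk x y hy)) : a ≤ fibreInf φ x :=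
  have := hne.to_subtype
  le_ciInf fun y => h y.1 y.2

theorem abs_fibreInf_sub_le {x : X} (hne : (F x).Nonempty)
    (hφ : BddBelow (Set.range φ)) (hψ : BddBelow (Set.range ψ)) {C : ℝ}
    (h : ∀ z, |φ z - ψ z| ≤ C) : |fibreInf φ x - fibreInf ψ x| ≤ C := by
  have hle {φ ψ : Graph F → ℝ} (hφ : BddBelow (Set.range φ)) (h : ∀ z, |φ z - ψ z| ≤ C) :
      fibreInf φ x - C ≤ fibreInf ψ x := le_fibreInf hne fun y hy => by
    have hinf := fibreInf_le_of_bddBelow hφ (Graph.mk x y hy)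
    linarith [(abs_le.1 (h (Graph.mk x y hy))).2]
  have hφψ := hle hφ h
  have hψφ := hle hψ fun z => abs_sub_comm (φ z) (ψ z) ▸ h z
  exact abs_le.2 ⟨by linarith, by linarith⟩

variable [TopologicalSpace X] [TopologicalSpace Y]

theorem isClosedMap_graph_fst (hc : ∀ x, IsCompact (F x)) (hF : UpperHemicontinuous F) :
    IsClosedMap fun z : Graph F => z.1.1 := by
  intro W hW
  obtain ⟨W', hW', rfl⟩ := isClosed_induced_iff.1 hW
  refine isOpen_compl_iff.1 (isOpen_iff_mem_nhds.2 fun x hx => ?_)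
  have hsub : ({x} : Set X) ×ˢ F x ⊆ W'ᶜ := by
    rintro ⟨_, y⟩ ⟨rfl, hy⟩ hyW
    exact hx ⟨Graph.mk _ y hy, hyW, rfl⟩
  obtain ⟨U, O, hU, hO, hxU, hFO, hUO⟩ :=
    generalized_tube_lemma isCompact_singleton (hc x) hW'.isOpen_compl hsub
  filter_upwards [hU.mem_nhds (hxU rfl), hF.forall_isOpen x O hO hFO] with x' hx' hFx'
  rintro ⟨z, hz, rfl⟩
  exact hUO (Set.mk_mem_prod hx' (hFx' z.2)) hz

theorem lowerSemicontinuous_fibre (hφ : LowerSemicontinuous φ) (x : X) :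
    LowerSemicontinuous fun y : F x => φ (Graph.mk x y.1 y.2) :=
  hφ.comp (g := fun y : F x => Graph.mk x y.1 y.2) (by fun_prop)

theorem bddBelow_range_fibre (hc : ∀ x, IsCompact (F x)) (hφ : LowerSemicontinuous φ) (x : X) :
    BddBelow (Set.range fun y : F x => φ (Graph.mk x y.1 y.2)) := by
  have := isCompact_iff_compactSpace.1 (hc x)
  have hlsc := (lowerSemicontinuous_fibre hφ x).lowerSemicontinuousOn Set.univ
  simpa only [Set.image_univ] using hlsc.bddBelow_of_isCompact isCompact_univ

theorem exists_min_fibre_inter (hc : ∀ x, IsCompact (F x)) (hφ : LowerSemicontinuous φ) {x : X}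
    {C : Set Y} (hC : IsClosed C) (hne : (F x ∩ C).Nonempty) :
    ∃ y ∈ C, ∃ hy : y ∈ F x, ∀ y' ∈ C, ∀ hy' : y' ∈ F x,
      φ (Graph.mk x y hy) ≤ φ (Graph.mk x y' hy') := by
  have := isCompact_iff_compactSpace.1 (hc x)
  obtain ⟨y₀, hy₀, hy₀C⟩ := hne
  obtain ⟨y, hyC, hmin⟩ := ((lowerSemicontinuous_fibre hφ x).lowerSemicontinuousOn _).exists_isMinOn
    ⟨⟨y₀, hy₀⟩, hy₀C⟩ (hC.preimage continuous_subtype_val).isCompact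
  exact ⟨y.1, hyC, y.2, fun y' hy'C hy' => hmin (a := ⟨y', hy'⟩) hy'C⟩

/-- The minimizers of a function on the graph of `F` over the fibre above `x`. -/
def argminFibre (φ : Graph F → ℝ) (x : X) : Set Y :=
  {y | ∃ hy : y ∈ F x, φ (Graph.mk x y hy) ≤ fibreInf φ x}

theorem argminFibre_nonempty (hne : ∀ x, (F x).Nonempty) (hc : ∀ x, IsCompact (F x))
    (hφ : LowerSemicontinuous φ) (x : X) : (argminFibre φ x).Nonempty := by
  obtain ⟨y, -, hy, hmin⟩ := exists_min_fibre_inter hc hφ isClosed_univ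
    ((Set.inter_univ (F x)).symm ▸ hne x)
  exact ⟨y, hy, le_fibreInf (hne x) fun y' hy' => hmin y' trivial hy'⟩

theorem isClosed_argminFibre [T2Space Y] (hc : ∀ x, IsCompact (F x)) (hφ : LowerSemicontinuous φ)
    (x : X) : IsClosed (argminFibre φ x) := by
  have himage : argminFibre φ x =
      Subtype.val '' {y : F x | φ (Graph.mk x y.1 y.2) ≤ fibreInf φ x} := by
    ext y
    simp [argminFibre]
  rw [himage]
  exact (hc x).isClosed.isClosedEmbedding_subtypeVal.isClosedMap _ 
    ((lowerSemicontinuous_fibre hφ x).isClosed_preimage _)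

theorem lowerSemicontinuous_fibreInf (hne : ∀ x, (F x).Nonempty) (hc : ∀ x, IsCompact (F x))
    (hF : UpperHemicontinuous F) (hφ : LowerSemicontinuous φ) :
    LowerSemicontinuous (fibreInf φ) := by
  refine lowerSemicontinuous_iff_isClosed_preimage.2 fun a => ?_
  have hsublevel : fibreInf φ ⁻¹' Set.Iic a =
      (fun z : Graph F => z.1.1) '' (φ ⁻¹' Set.Iic a) := by
    ext x
    constructor
    · intro hx
      obtain ⟨y, hy, hle⟩ := argminFibre_nonempty hne hc hφ x
      exact ⟨Graph.mk x y hy, hle.trans hx, rfl⟩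
    · rintro ⟨z, hz, rfl⟩
      exact (fibreInf_le (bddBelow_range_fibre hc hφ _)).trans hz
  rw [hsublevel]
  exact isClosedMap_graph_fst hc hF _ (hφ.isClosed_preimage a)

variable [MeasurableSpace X] [OpensMeasurableSpace X]

theorem measurableSet_argminFibre_inter (hne : ∀ x, (F x).Nonempty)
    (hc : ∀ x, IsCompact (F x)) (hF : UpperHemicontinuous F) (hφ : LowerSemicontinuous φ)
    {C : Set Y} (hC : IsClosed C) : MeasurableSet {x | (argminFibre φ x ∩ C).Nonempty} := by
  -- The minimum over the fibre is attained in `C` iff, for every rational `q`, the sublevel set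
  -- `{φ ≤ q}` meets `C` above `x` as soon as `q` exceeds the minimum.
  have hrat : {x | (argminFibre φ x ∩ C).Nonempty} = ⋂ q : ℚ, {x | fibreInf φ x < q}ᶜ ∪
      (fun z : Graph F => z.1.1) '' (φ ⁻¹' Set.Iic (q : ℝ) ∩ {z | z.1.2 ∈ C}) := by
    ext x
    simp only [Set.mem_iInter, Set.mem_union, Set.mem_compl_iff, ← imp_iff_not_or]
    constructor
    · rintro ⟨y, ⟨hy, hle⟩, hyC⟩ q hq
      exact ⟨Graph.mk x y hy, ⟨hle.trans (le_of_lt hq), hyC⟩, rfl⟩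
    · intro hx
      obtain ⟨q₀, hq₀⟩ := exists_rat_gt (fibreInf φ x)
      obtain ⟨z₀, ⟨-, hz₀C⟩, rfl⟩ := hx q₀ hq₀
      obtain ⟨y, hyC, hy, hmin⟩ := exists_min_fibre_inter hc hφ hC ⟨z₀.1.2, z₀.2, hz₀C⟩
      refine ⟨y, ⟨hy, le_of_forall_lt_rat_imp_le fun q hq => ?_⟩, hyC⟩
      obtain ⟨⟨⟨_, y'⟩, hy'⟩, ⟨hle, hy'C⟩, rfl⟩ := hx q hq
      exact (hmin y' hy'C hy').trans hle
  rw [hrat]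
  refine .iInter fun q => .union ?_ (isClosedMap_graph_fst hc hF _ ?_).measurableSet
  · exact (measurableSet_lt (lowerSemicontinuous_fibreInf hne hc hF hφ).measurable
      measurable_const).compl
  · exact (hφ.isClosed_preimage _).inter (hC.preimage (by fun_prop))

theorem exists_measurable_argminFibre [PolishSpace Y] [MeasurableSpace Y] [BorelSpace Y]
    (hne : ∀ x, (F x).Nonempty) (hc : ∀ x, IsCompact (F x)) (hF : UpperHemicontinuous F)
    (hφ : LowerSemicontinuous φ) : ∃ s : X → Y, Measurable s ∧ ∀ x, s x ∈ argminFibre φ x :=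
  MeasurableClosedValued.exists_measurable_selection
    ⟨argminFibre_nonempty hne hc hφ, isClosed_argminFibre hc hφ,
      fun _ hC => measurableSet_argminFibre_inter hne hc hF hφ hC⟩

end FibreInf

section LowerEnvelope

variable {X Y H : Type*} [NormedAddCommGroup H] [InnerProductSpace ℝ H]
  {F : X → Set Y} {g : Graph F → H} {M : ℝ}

theorem abs_gLam_le (hM : ∀ z, ‖g z‖ ≤ M) (lam : H) (z : Graph F) : |gLam g lam z| ≤ ‖lam‖ * M :=
  (abs_real_inner_le_norm _ _).trans (mul_le_mul_of_nonneg_left (hM z) (norm_nonneg _))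

theorem bddBelow_range_gLam (hM : ∀ z, ‖g z‖ ≤ M) (lam : H) : BddBelow (Set.range (gLam g lam)) :=
  ⟨-(‖lam‖ * M), Set.forall_mem_range.2 fun z => (abs_le.1 (abs_gLam_le hM lam z)).1⟩

theorem u_le_gLam (hM : ∀ z, ‖g z‖ ≤ M) (lam : H) (z : Graph F) : u g lam z.1.1 ≤ gLam g lam z :=
  fibreInf_le_of_bddBelow (bddBelow_range_gLam hM lam) z

theorem abs_u_le (hM : ∀ z, ‖g z‖ ≤ M) {x : X} (hne : (F x).Nonempty) (lam : H) :
    |u g lam x| ≤ ‖lam‖ * M := by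
  obtain ⟨y, hy⟩ := hne
  exact abs_le.2 ⟨le_fibreInf ⟨y, hy⟩ fun y hy => (abs_le.1 (abs_gLam_le hM lam _)).1,
    (u_le_gLam hM lam (Graph.mk x y hy)).trans (abs_le.1 (abs_gLam_le hM lam _)).2⟩

theorem abs_u_sub_u_le (hM : ∀ z, ‖g z‖ ≤ M) {x : X} (hne : (F x).Nonempty) (lam lam' : H) :
    |u g lam x - u g lam' x| ≤ ‖lam - lam'‖ * M :=
  abs_fibreInf_sub_le hne (bddBelow_range_gLam hM lam) (bddBelow_range_gLam hM lam') fun z => by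
    simpa only [gLam, inner_sub_left] using abs_gLam_le hM (lam - lam') z

theorem integrable_u [TopologicalSpace X] [TopologicalSpace Y] [MeasurableSpace X]
    [OpensMeasurableSpace X] (hM : ∀ z, ‖g z‖ ≤ M) (hne : ∀ x, (F x).Nonempty)
    (hc : ∀ x, IsCompact (F x)) (hF : UpperHemicontinuous F) {lam : H}
    (hlam : LowerSemicontinuous (gLam g lam)) (m : Measure X) [IsFiniteMeasure m] :
    Integrable (u g lam) m :=
  .of_bound (lowerSemicontinuous_fibreInf hne hc hF hlam).measurable.aestronglyMeasurable
    (‖lam‖ * M) (Eventually.of_forall fun x => abs_u_le hM (hne x) lam)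

theorem abs_integralDiff_u_sub_le [MeasurableSpace X] (hM : ∀ z, ‖g z‖ ≤ M)
    (hne : ∀ x, (F x).Nonempty) {lam lam' : H} {m₀ m₁ : Measure X} [IsProbabilityMeasure m₀]
    [IsProbabilityMeasure m₁] (h₀ : Integrable (u g lam) m₀) (h₁ : Integrable (u g lam) m₁)
    (h₀' : Integrable (u g lam') m₀) (h₁' : Integrable (u g lam') m₁) :
    |integralDiff (u g lam) m₀ m₁ - integralDiff (u g lam') m₀ m₁| ≤ 2 * M * ‖lam - lam'‖ := by
  have hbound {m : Measure X} [IsProbabilityMeasure m] (hu : Integrable (u g lam) m)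
      (hu' : Integrable (u g lam') m) :
      |∫ x, u g lam x ∂m - ∫ x, u g lam' x ∂m| ≤ ‖lam - lam'‖ * M := by
    rw [← integral_sub hu hu']
    simpa using norm_integral_le_of_norm_le_const (μ := m)
      (f := fun x => u g lam x - u g lam' x)
      (Eventually.of_forall fun x => abs_u_sub_u_le hM (hne x) lam lam')
  have hm₀ := abs_le.1 (hbound h₀ h₀')
  have hm₁ := abs_le.1 (hbound h₁ h₁')
  simp only [integralDiff]
  exact abs_le.2 ⟨by linarith [hm₀.2, hm₁.1], by linarith [hm₀.1, hm₁.2]⟩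

end LowerEnvelope

section Aggregates

variable {X Y H : Type*} [MeasurableSpace X] [MeasurableSpace Y] [NormedAddCommGroup H]
  {F : X → Set Y} {g : Graph F → H} {M : ℝ} {m : Measure X}

theorem measurable_graph_fst : Measurable fun z : Graph F => z.1.1 :=
  measurable_fst.comp measurable_subtype_coe

theorem integrable_of_norm_le (hM : ∀ z, ‖g z‖ ≤ M) (hg : StronglyMeasurable g)
    (μ : Measure (Graph F)) [IsFiniteMeasure μ] : Integrable g μ :=
  .of_bound hg.aestronglyMeasurable M (Eventually.of_forall hM)

variable [InnerProductSpace ℝ H]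

theorem norm_le_of_mem_aggregates (hM : ∀ z, ‖g z‖ ≤ M) {β : H} (hβ : β ∈ aggregates g m) :
    ‖β‖ ≤ M := by
  obtain ⟨μ, ⟨hμ, -⟩, rfl⟩ := hβ
  simpa using norm_integral_le_of_norm_le_const (μ := μ) (Eventually.of_forall hM)

theorem convex_aggregates (hM : ∀ z, ‖g z‖ ≤ M) (hg : StronglyMeasurable g) (m : Measure X) :
    Convex ℝ (aggregates g m) := by
  rintro _ ⟨μ, ⟨hμ, hμm⟩, rfl⟩ _ ⟨ν, ⟨hν, hνm⟩, rfl⟩ a b ha hb hab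
  have hab' : ENNReal.ofReal a + ENNReal.ofReal b = 1 := by
    rw [← ENNReal.ofReal_add ha hb, hab, ENNReal.ofReal_one]
  refine ⟨ENNReal.ofReal a • μ + ENNReal.ofReal b • ν, ⟨⟨by simp [hab']⟩, ?_⟩, ?_⟩
  · rw [Measure.map_add _ _ measurable_graph_fst, Measure.map_smul, Measure.map_smul, hμm, hνm,
      ← add_smul, hab', one_smul]
  · dsimp only
    rw [integral_add_measure
      ((integrable_of_norm_le hM hg μ).smul_measure ENNReal.ofReal_ne_top)
      ((integrable_of_norm_le hM hg ν).smul_measure ENNReal.ofReal_ne_top),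
      integral_smul_measure, integral_smul_measure, ENNReal.toReal_ofReal ha,
      ENNReal.toReal_ofReal hb]

theorem integral_comp_section_mem_aggregates (hg : StronglyMeasurable g) {r : X → Graph F}
    (hr : Measurable r) (hsection : ∀ x, (r x).1.1 = x) (m : Measure X) [IsProbabilityMeasure m] :
    ∫ x, g (r x) ∂m ∈ aggregates g m := by
  refine ⟨m.map r, ⟨Measure.isProbabilityMeasure_map hr.aemeasurable, ?_⟩,
    integral_map hr.aemeasurable hg.aestronglyMeasurable⟩
  rw [Measure.map_map measurable_graph_fst hr]
  simp only [Function.comp_def, hsection, Measure.map_id']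

theorem costs_eq_image_aggregates (f : H → ℝ) (g : Graph F → H) (m : Measure X) :
    costs f g m = f '' aggregates g m :=
  (Set.image_image f _ _).symm

variable [CompleteSpace H] {lam : H}

theorem integral_u_le_inner (hM : ∀ z, ‖g z‖ ≤ M) (hg : StronglyMeasurable g)
    (hu : Integrable (u g lam) m) {β : H} (hβ : β ∈ aggregates g m) :
    ∫ x, u g lam x ∂m ≤ inner ℝ lam β := by
  obtain ⟨μ, ⟨hμ, rfl⟩, rfl⟩ := hβ
  have hgμ := integrable_of_norm_le hM hg μ
  calc ∫ x, u g lam x ∂(μ.map fun z : Graph F => z.1.1) = ∫ z : Graph F, u g lam z.1.1 ∂μ :=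
        integral_map measurable_graph_fst.aemeasurable hu.aestronglyMeasurable
    _ ≤ ∫ z, gLam g lam z ∂μ :=
        integral_mono (hu.comp_measurable measurable_graph_fst) (hgμ.const_inner lam)
          (u_le_gLam hM lam)
    _ = inner ℝ lam (∫ z, g z ∂μ) := integral_inner hgμ lam

theorem exists_aggregate_inner_eq [TopologicalSpace X] [OpensMeasurableSpace X]
    [TopologicalSpace Y] [PolishSpace Y] [BorelSpace Y] (hM : ∀ z, ‖g z‖ ≤ M)
    (hg : StronglyMeasurable g) (hne : ∀ x, (F x).Nonempty) (hc : ∀ x, IsCompact (F x))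
    (hF : UpperHemicontinuous F) (hlam : LowerSemicontinuous (gLam g lam)) (m : Measure X)
    [IsProbabilityMeasure m] : ∃ β ∈ aggregates g m, inner ℝ lam β = ∫ x, u g lam x ∂m := by
  obtain ⟨s, hs, hmin⟩ := exists_measurable_argminFibre hne hc hF hlam
  let r : X → Graph F := fun x => Graph.mk x (s x) (hmin x).1
  have hr : Measurable r := (measurable_id.prodMk hs).subtype_mk
  have hgr : Integrable (g ∘ r) m :=
    .of_bound (hg.comp_measurable hr).aestronglyMeasurable M
      (Eventually.of_forall fun x => hM (r x))
  refine ⟨_, integral_comp_section_mem_aggregates hg hr (fun _ => rfl) m, ?_⟩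
  calc inner ℝ lam (∫ x, g (r x) ∂m) = ∫ x, gLam g lam (r x) ∂m := (integral_inner hgr lam).symm
    _ = ∫ x, u g lam x ∂m := integral_congr_ae <| Eventually.of_forall fun x =>
        (hmin x).2.antisymm (u_le_gLam hM lam (r x))

end Aggregates

section Segment

variable {X : Type*} [MeasurableSpace X] {m₀ m₁ : Measure X} {t : ℝ}

theorem segment_zero (m₀ m₁ : Measure X) : segment m₀ m₁ 0 = m₀ := by simp [segment]

theorem segment_one (m₀ m₁ : Measure X) : segment m₀ m₁ 1 = m₁ := by simp [segment]

theorem isProbabilityMeasure_segment [IsProbabilityMeasure m₀] [IsProbabilityMeasure m₁]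
    (ht : t ∈ Set.Icc (0 : ℝ) 1) : IsProbabilityMeasure (segment m₀ m₁ t) :=
  ⟨by simp [segment, ← ENNReal.ofReal_add (sub_nonneg.2 ht.2) ht.1]⟩

theorem integral_segment {φ : X → ℝ} (h₀ : Integrable φ m₀) (h₁ : Integrable φ m₁)
    (ht : t ∈ Set.Icc (0 : ℝ) 1) :
    ∫ x, φ x ∂(segment m₀ m₁ t) = ∫ x, φ x ∂m₀ + t * integralDiff φ m₀ m₁ := by
  rw [segment, integral_add_measure (h₀.smul_measure ENNReal.ofReal_ne_top)
    (h₁.smul_measure ENNReal.ofReal_ne_top), integral_smul_measure, integral_smul_measure,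
    ENNReal.toReal_ofReal (sub_nonneg.2 ht.2), ENNReal.toReal_ofReal ht.1, integralDiff]
  simp only [smul_eq_mul]
  ring

theorem integralDiff_segment {φ : X → ℝ} (h₀ : Integrable φ m₀) (h₁ : Integrable φ m₁) {s : ℝ}
    (hs : s ∈ Set.Icc (0 : ℝ) 1) (ht : t ∈ Set.Icc (0 : ℝ) 1) :
    integralDiff φ (segment m₀ m₁ s) (segment m₀ m₁ t) = (t - s) * integralDiff φ m₀ m₁ := by
  rw [integralDiff, integral_segment h₀ h₁ hs, integral_segment h₀ h₁ ht]
  ring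

theorem segment_mem_P1 {X : Type*} [MetricSpace X] [MeasurableSpace X] {m₀ m₁ : Measure X}
    (h₀ : m₀ ∈ P1 X) (h₁ : m₁ ∈ P1 X) {t : ℝ} (ht : t ∈ Set.Icc (0 : ℝ) 1) :
    segment m₀ m₁ t ∈ P1 X := by
  obtain ⟨hp₀, x₀, hx₀⟩ := h₀
  obtain ⟨hp₁, x₁, hx₁⟩ := h₁
  have hx : ∫⁻ x, edist x x₀ ∂m₁ < ∞ := by
    calc ∫⁻ x, edist x x₀ ∂m₁ ≤ ∫⁻ x, edist x x₁ + edist x₁ x₀ ∂m₁ :=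
          lintegral_mono fun x => edist_triangle _ _ _
      _ = ∫⁻ x, edist x x₁ ∂m₁ + edist x₁ x₀ := by
          rw [lintegral_add_right _ measurable_const]; simp
      _ < ∞ := ENNReal.add_lt_top.2 ⟨hx₁, edist_lt_top _ _⟩
  refine ⟨isProbabilityMeasure_segment ht, x₀, ?_⟩
  rw [segment, lintegral_add_measure, lintegral_smul_measure, lintegral_smul_measure]
  exact ENNReal.add_lt_top.2 ⟨ENNReal.mul_lt_top ENNReal.ofReal_lt_top hx₀,
    ENNReal.mul_lt_top ENNReal.ofReal_lt_top hx⟩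

end Segment

section Subgradient

variable {φ p : ℝ → ℝ} {a b : ℝ}

theorem hasDerivWithinAt_of_subgradient {I : Set ℝ} {t : ℝ}
    (hφ : ∀ s ∈ I, ∀ t ∈ I, φ s + (t - s) * p s ≤ φ t) (hp : ContinuousWithinAt p I t)
    (ht : t ∈ I) : HasDerivWithinAt φ (p t) I t := by
  rw [hasDerivWithinAt_iff_isLittleO, Asymptotics.isLittleO_iff]
  intro ε hε
  filter_upwards [Metric.continuousWithinAt_iff'.1 hp ε hε, self_mem_nhdsWithin] with s hs hsI
  have hts := hφ t ht s hsI
  have hst := hφ s hsI t ht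
  calc ‖φ s - φ t - (s - t) • p t‖ = φ s - φ t - (s - t) * p t :=
        Real.norm_of_nonneg (by rw [smul_eq_mul]; linarith)
    _ ≤ (p s - p t) * (s - t) := by linarith
    _ ≤ |p s - p t| * |s - t| := by rw [← abs_mul]; exact le_abs_self _
    _ ≤ ε * ‖s - t‖ := mul_le_mul_of_nonneg_right hs.le (abs_nonneg _)

theorem tendsto_slope_nhdsGT_of_subgradient (hab : a < b)
    (hφ : ∀ s ∈ Set.Icc a b, ∀ t ∈ Set.Icc a b, φ s + (t - s) * p s ≤ φ t)
    (hp : ContinuousOn p (Set.Icc a b)) : Tendsto (slope φ a) (𝓝[>] a) (𝓝 (p a)) := by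
  have ha := Set.left_mem_Icc.2 hab.le
  have hderiv := (hasDerivWithinAt_of_subgradient hφ (hp a ha) ha).mono Set.Ioo_subset_Icc_self
  exact (hasDerivWithinAt_iff_tendsto_slope' (by simp)).1 (hderiv.Ioi_of_Ioo hab)

theorem sub_eq_integral_of_subgradient (hab : a ≤ b)
    (hφ : ∀ s ∈ Set.Icc a b, ∀ t ∈ Set.Icc a b, φ s + (t - s) * p s ≤ φ t)
    (hp : ContinuousOn p (Set.Icc a b)) : φ b - φ a = ∫ t in a..b, p t := by
  have hderiv t (ht : t ∈ Set.Icc a b) := hasDerivWithinAt_of_subgradient hφ (hp t ht) ht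
  exact (intervalIntegral.integral_eq_sub_of_hasDerivAt_of_le hab
    (fun t ht => (hderiv t ht).continuousWithinAt)
    (fun t ht => (hderiv t (Set.Ioo_subset_Icc_self ht)).hasDerivAt (Icc_mem_nhds ht.1 ht.2))
    (hp.intervalIntegrable_of_Icc hab)).symm

end Subgradient

section Optimality

variable {X Y H : Type*} [MeasurableSpace X] [NormedAddCommGroup H] [InnerProductSpace ℝ H]
  {F : X → Set Y} {f : H → ℝ} {g : Graph F → H} {m : Measure X} {β : H}

theorem coe_inner_sub_sub_le_dualObj (f : H → ℝ) (g : Graph F → H) (m : Measure X) (lam y : H) :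
    ((inner ℝ lam y - f y - ∫ x, u g lam x ∂m : ℝ) : EReal) ≤ dualObj f g m lam := by
  rw [EReal.coe_sub]
  exact EReal.sub_le_sub (le_fenchelConj f lam y) le_rfl

variable [MeasurableSpace Y]

/-- `β` minimizes `f` over `G_m`: it is the aggregate of an optimal `μ ∈ 𝒫_m(Z)`. -/
def IsOptimalAggregate (f : H → ℝ) (g : Graph F → H) (m : Measure X) (β : H) : Prop :=
  β ∈ aggregates g m ∧ IsMinOn f (aggregates g m) β

theorem IsOptimalAggregate.isLeast_costs (hβ : IsOptimalAggregate f g m β) :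
    IsLeast (costs f g m) (f β) := by
  rw [costs_eq_image_aggregates]
  exact ⟨Set.mem_image_of_mem f hβ.1, Set.forall_mem_image.2 hβ.2⟩

theorem IsOptimalAggregate.V_eq (hβ : IsOptimalAggregate f g m β) : V f g m = f β :=
  hβ.isLeast_costs.csInf_eq

end Optimality

section Duality

variable {X Y H : Type*} [TopologicalSpace X] [MeasurableSpace X] [TopologicalSpace Y]
  [MeasurableSpace Y] [NormedAddCommGroup H] [InnerProductSpace ℝ H] {F : X → Set Y} {f : H → ℝ}
  {g : Graph F → H} {m m' : Measure X} {β β' : H}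

/-- The assumptions under which strong duality holds. Compactness of the fibres and upper
semicontinuity of `F` make `u_λ`, `λ ∈ dom f*`, lower semicontinuous and hence measurable. -/
structure CompactDualityAssumption (F : X → Set Y) (f : H → ℝ) (g : Graph F → H) : Prop where
  nonempty_fibres : ∀ x, (F x).Nonempty
  compact_fibres : ∀ x, IsCompact (F x)
  usc_F : UpperHemicontinuous F
  bounded_g : ∃ M : ℝ, ∀ z, ‖g z‖ ≤ M
  stronglyMeasurable_g : StronglyMeasurable g
  convex_f : ConvexOn ℝ Set.univ f
  differentiable_f : Differentiable ℝ f
  lsc_gLam : ∀ lam ∈ domConj f, LowerSemicontinuous (gLam g lam)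

namespace CompactDualityAssumption

theorem integrable_u [OpensMeasurableSpace X] (h : CompactDualityAssumption F f g) {lam : H}
    (hlam : lam ∈ domConj f) (m : Measure X) [IsFiniteMeasure m] : Integrable (u g lam) m :=
  have ⟨_, hM⟩ := h.bounded_g
  MFO.integrable_u hM h.nonempty_fibres h.compact_fibres h.usc_F (h.lsc_gLam lam hlam) m

variable [CompleteSpace H]

theorem gradient_mem_domConj (h : CompactDualityAssumption F f g) (β : H) :
    gradient f β ∈ domConj f :=
  mem_domConj_of_hasGradientAt h.convex_f (h.differentiable_f β).hasGradientAt

theorem integral_u_le_inner [OpensMeasurableSpace X] (h : CompactDualityAssumption F f g) {lam : H}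
    (hlam : lam ∈ domConj f) [IsFiniteMeasure m] (hβ : β ∈ aggregates g m) :
    ∫ x, u g lam x ∂m ≤ inner ℝ lam β :=
  have ⟨_, hM⟩ := h.bounded_g
  MFO.integral_u_le_inner hM h.stronglyMeasurable_g (h.integrable_u hlam m) hβ

variable [OpensMeasurableSpace X] [PolishSpace Y] [BorelSpace Y]

theorem exists_aggregate_inner_eq (h : CompactDualityAssumption F f g) {lam : H}
    (hlam : lam ∈ domConj f) (m : Measure X) [IsProbabilityMeasure m] :
    ∃ β ∈ aggregates g m, inner ℝ lam β = ∫ x, u g lam x ∂m :=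
  have ⟨_, hM⟩ := h.bounded_g
  MFO.exists_aggregate_inner_eq hM h.stronglyMeasurable_g h.nonempty_fibres h.compact_fibres
    h.usc_F (h.lsc_gLam lam hlam) m

theorem exists_isOptimalAggregate (h : CompactDualityAssumption F f g) (m : Measure X)
    [IsProbabilityMeasure m] (hG : IsClosed (aggregates g m)) :
    ∃ β, IsOptimalAggregate f g m β := by
  obtain ⟨M, hM⟩ := h.bounded_g
  obtain ⟨β₀, hβ₀, -⟩ := h.exists_aggregate_inner_eq (h.gradient_mem_domConj 0) m
  have hbdd : Bornology.IsBounded (aggregates g m) :=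
    isBounded_iff_forall_norm_le.2 ⟨M, fun _ => norm_le_of_mem_aggregates hM⟩
  exact exists_isMinOn_of_convexOn h.convex_f
    h.differentiable_f.continuous.lowerSemicontinuous ⟨β₀, hβ₀⟩ hG
    (convex_aggregates hM h.stronglyMeasurable_g m) hbdd

/-- First-order optimality: `β` also minimizes the linearized cost `⟨∇f(β), ·⟩` over `G_m`, and a
measurable selection of the fibrewise minimizers shows that this minimum is `∫ u_{∇f(β)} dm`. -/
theorem integral_u_gradient_eq (h : CompactDualityAssumption F f g) [IsProbabilityMeasure m]
    (hβ : IsOptimalAggregate f g m β) :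
    ∫ x, u g (gradient f β) x ∂m = inner ℝ (gradient f β) β := by
  obtain ⟨M, hM⟩ := h.bounded_g
  obtain ⟨b, hb, hbu⟩ := h.exists_aggregate_inner_eq (h.gradient_mem_domConj β) m
  have hfirst := inner_sub_nonneg_of_isMinOn (convex_aggregates hM h.stronglyMeasurable_g m) hβ.2
    (h.differentiable_f β).hasGradientAt hβ.1 hb
  rw [inner_sub_right, sub_nonneg, hbu] at hfirst
  exact (h.integral_u_le_inner (h.gradient_mem_domConj β) hβ.1).antisymm hfirst

theorem dualObj_gradient_eq (h : CompactDualityAssumption F f g) [IsProbabilityMeasure m]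
    (hβ : IsOptimalAggregate f g m β) : dualObj f g m (gradient f β) = ((-f β : ℝ) : EReal) := by
  rw [dualObj, h.integral_u_gradient_eq hβ, fenchelConj_eq_of_hasGradientAt h.convex_f
    (h.differentiable_f β).hasGradientAt, ← EReal.coe_sub, sub_sub_cancel_left]

theorem isDualSolution_iff (h : CompactDualityAssumption F f g) [IsProbabilityMeasure m]
    (hβ : IsOptimalAggregate f g m β) {lam : H} :
    IsDualSolution f g m lam ↔ lam = gradient f β := by
  constructor
  · rintro ⟨hlam, hmin⟩
    refine eq_of_forall_add_inner_sub_le (h.differentiable_f β).hasGradientAt fun y => ?_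
    have hdual := (coe_inner_sub_sub_le_dualObj f g m lam y).trans
      ((hmin (h.gradient_mem_domConj β)).trans_eq (h.dualObj_gradient_eq hβ))
    have hu := h.integral_u_le_inner hlam hβ.1
    rw [EReal.coe_le_coe_iff] at hdual
    rw [inner_sub_right]
    linarith
  · rintro rfl
    refine ⟨h.gradient_mem_domConj β, fun lam hlam => ?_⟩
    have hu := h.integral_u_le_inner hlam hβ.1
    calc dualObj f g m (gradient f β) = ((-f β : ℝ) : EReal) := h.dualObj_gradient_eq hβ
      _ ≤ ((inner ℝ lam β - f β - ∫ x, u g lam x ∂m : ℝ) : EReal) :=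
          EReal.coe_le_coe_iff.2 (by linarith)
      _ ≤ dualObj f g m lam := coe_inner_sub_sub_le_dualObj f g m lam β

theorem dualSolution_eq (h : CompactDualityAssumption F f g) [IsProbabilityMeasure m]
    (hβ : IsOptimalAggregate f g m β) : dualSolution f g m = gradient f β :=
  (h.isDualSolution_iff hβ).1
    (Classical.epsilon_spec ⟨gradient f β, (h.isDualSolution_iff hβ).2 rfl⟩)

theorem dualSolution_mem_domConj (h : CompactDualityAssumption F f g) [IsProbabilityMeasure m]
    (hG : IsClosed (aggregates g m)) : dualSolution f g m ∈ domConj f := by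
  obtain ⟨β, hβ⟩ := h.exists_isOptimalAggregate m hG
  exact h.dualSolution_eq hβ ▸ h.gradient_mem_domConj β

theorem isGLB_costs (h : CompactDualityAssumption F f g) [IsProbabilityMeasure m]
    (hG : IsClosed (aggregates g m)) : IsGLB (costs f g m) (V f g m) := by
  obtain ⟨β, hβ⟩ := h.exists_isOptimalAggregate m hG
  exact hβ.V_eq ▸ hβ.isLeast_costs.isGLB

theorem existsUnique_isDualSolution (h : CompactDualityAssumption F f g) [IsProbabilityMeasure m]
    (hG : IsClosed (aggregates g m)) : ∃! lam, IsDualSolution f g m lam := by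
  obtain ⟨β, hβ⟩ := h.exists_isOptimalAggregate m hG
  exact ⟨gradient f β, (h.isDualSolution_iff hβ).2 rfl, fun _ => (h.isDualSolution_iff hβ).1⟩

theorem integrable_v (h : CompactDualityAssumption F f g) [IsProbabilityMeasure m]
    (hG : IsClosed (aggregates g m)) (m' : Measure X) [IsFiniteMeasure m'] :
    Integrable (v f g m) m' :=
  h.integrable_u (h.dualSolution_mem_domConj hG) m'

theorem integralDiff_v_le_inner (h : CompactDualityAssumption F f g) [IsProbabilityMeasure m]
    [IsFiniteMeasure m'] (hβ : IsOptimalAggregate f g m β) (hβ' : β' ∈ aggregates g m') :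
    integralDiff (v f g m) m m' ≤ inner ℝ (gradient f β) (β' - β) := by
  have hv : v f g m = u g (gradient f β) := funext fun x => by rw [v, h.dualSolution_eq hβ]
  rw [integralDiff, hv, h.integral_u_gradient_eq hβ, inner_sub_right]
  exact sub_le_sub_right (h.integral_u_le_inner (h.gradient_mem_domConj β) hβ') _

theorem V_add_integralDiff_v_le (h : CompactDualityAssumption F f g) [IsProbabilityMeasure m]
    [IsProbabilityMeasure m'] (hG : IsClosed (aggregates g m)) (hG' : IsClosed (aggregates g m')) :
    V f g m + integralDiff (v f g m) m m' ≤ V f g m' := by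
  obtain ⟨β, hβ⟩ := h.exists_isOptimalAggregate m hG
  obtain ⟨β', hβ'⟩ := h.exists_isOptimalAggregate m' hG'
  calc V f g m + integralDiff (v f g m) m m' ≤ f β + inner ℝ (gradient f β) (β' - β) :=
        add_le_add hβ.V_eq.le (h.integralDiff_v_le_inner hβ hβ'.1)
    _ ≤ f β' :=
        add_inner_sub_le_of_hasGradientAt h.convex_f (h.differentiable_f β).hasGradientAt β'
    _ = V f g m' := hβ'.V_eq.symm

theorem norm_sq_dualSolution_sub_le (h : CompactDualityAssumption F f g) {L : ℝ≥0}
    (hL : LipschitzWith L (gradient f)) [IsProbabilityMeasure m] [IsProbabilityMeasure m']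
    (hG : IsClosed (aggregates g m)) (hG' : IsClosed (aggregates g m')) :
    ‖dualSolution f g m' - dualSolution f g m‖ ^ 2
      ≤ 4 * L * (V f g m' - V f g m - integralDiff (v f g m) m m') := by
  obtain ⟨β, hβ⟩ := h.exists_isOptimalAggregate m hG
  obtain ⟨β', hβ'⟩ := h.exists_isOptimalAggregate m' hG'
  rw [h.dualSolution_eq hβ, h.dualSolution_eq hβ', hβ.V_eq, hβ'.V_eq]
  calc ‖gradient f β' - gradient f β‖ ^ 2
      ≤ 4 * L * (f β' - f β - inner ℝ (gradient f β) (β' - β)) :=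
        norm_sq_gradient_sub_le h.convex_f h.differentiable_f hL β β'
    _ ≤ 4 * L * (f β' - f β - integralDiff (v f g m) m m') := by
        gcongr
        exact h.integralDiff_v_le_inner hβ hβ'.1

theorem norm_sq_dualSolution_sub_le_integralDiff (h : CompactDualityAssumption F f g) {L : ℝ≥0}
    (hL : LipschitzWith L (gradient f)) [IsProbabilityMeasure m] [IsProbabilityMeasure m']
    (hG : IsClosed (aggregates g m)) (hG' : IsClosed (aggregates g m')) :
    ‖dualSolution f g m' - dualSolution f g m‖ ^ 2
      ≤ 2 * L * (integralDiff (v f g m') m m' - integralDiff (v f g m) m m') := by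
  have hmm' := h.norm_sq_dualSolution_sub_le hL hG hG'
  have hm'm := h.norm_sq_dualSolution_sub_le hL hG' hG
  rw [norm_sub_rev] at hm'm
  have hswap : integralDiff (v f g m') m' m = -integralDiff (v f g m') m m' := (neg_sub _ _).symm
  rw [hswap] at hm'm
  linarith

variable {m₀ m₁ : Measure X} [IsProbabilityMeasure m₀] [IsProbabilityMeasure m₁] {s t : ℝ}

theorem V_segment_add_le (h : CompactDualityAssumption F f g)
    (hG : ∀ t ∈ Set.Icc (0 : ℝ) 1, IsClosed (aggregates g (segment m₀ m₁ t)))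
    (hs : s ∈ Set.Icc (0 : ℝ) 1) (ht : t ∈ Set.Icc (0 : ℝ) 1) :
    V f g (segment m₀ m₁ s) + (t - s) * integralDiff (v f g (segment m₀ m₁ s)) m₀ m₁
      ≤ V f g (segment m₀ m₁ t) := by
  have := isProbabilityMeasure_segment (m₀ := m₀) (m₁ := m₁) hs
  have := isProbabilityMeasure_segment (m₀ := m₀) (m₁ := m₁) ht
  have hle := h.V_add_integralDiff_v_le (hG s hs) (hG t ht)
  rwa [integralDiff_segment (h.integrable_v (hG s hs) m₀) (h.integrable_v (hG s hs) m₁) hs ht]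
    at hle

theorem abs_integralDiff_v_segment_sub_le (h : CompactDualityAssumption F f g) {L : ℝ≥0}
    (hL : LipschitzWith L (gradient f)) {M : ℝ} (hM : ∀ z, ‖g z‖ ≤ M)
    (hG : ∀ t ∈ Set.Icc (0 : ℝ) 1, IsClosed (aggregates g (segment m₀ m₁ t)))
    (hs : s ∈ Set.Icc (0 : ℝ) 1) (ht : t ∈ Set.Icc (0 : ℝ) 1) :
    |integralDiff (v f g (segment m₀ m₁ t)) m₀ m₁ - integralDiff (v f g (segment m₀ m₁ s)) m₀ m₁|
      ≤ 8 * L * M ^ 2 * |t - s| := by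
  have := isProbabilityMeasure_segment (m₀ := m₀) (m₁ := m₁) hs
  have := isProbabilityMeasure_segment (m₀ := m₀) (m₁ := m₁) ht
  have hint {r : ℝ} (hr : r ∈ Set.Icc (0 : ℝ) 1) (m : Measure X) [IsProbabilityMeasure m] :
      Integrable (v f g (segment m₀ m₁ r)) m :=
    have := isProbabilityMeasure_segment (m₀ := m₀) (m₁ := m₁) hr
    h.integrable_v (hG r hr) m
  have hbound := abs_integralDiff_u_sub_le hM h.nonempty_fibres (hint ht m₀) (hint ht m₁)
    (hint hs m₀) (hint hs m₁)
  have hmono := h.norm_sq_dualSolution_sub_le_integralDiff hL (hG s hs) (hG t ht)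
  rw [integralDiff_segment (hint ht m₀) (hint ht m₁) hs ht,
    integralDiff_segment (hint hs m₀) (hint hs m₁) hs ht, ← mul_sub] at hmono
  set Δ : ℝ := integralDiff (v f g (segment m₀ m₁ t)) m₀ m₁
    - integralDiff (v f g (segment m₀ m₁ s)) m₀ m₁
  set δ : H := dualSolution f g (segment m₀ m₁ t) - dualSolution f g (segment m₀ m₁ s)
  have hquadratic : |Δ| * |Δ| ≤ 8 * L * M ^ 2 * |t - s| * |Δ| := calc
    |Δ| * |Δ| ≤ (2 * M * ‖δ‖) * (2 * M * ‖δ‖) :=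
        mul_self_le_mul_self (abs_nonneg _) hbound
    _ = 4 * M ^ 2 * ‖δ‖ ^ 2 := by ring
    _ ≤ 4 * M ^ 2 * (2 * L * |(t - s) * Δ|) := by
        gcongr
        exact hmono.trans (by gcongr; exact le_abs_self _)
    _ = 8 * L * M ^ 2 * |t - s| * |Δ| := by rw [abs_mul]; ring
  rcases (abs_nonneg Δ).eq_or_lt with hΔ | hΔ
  · rw [← hΔ]
    positivity
  · exact le_of_mul_le_mul_right hquadratic hΔ

theorem continuousOn_integralDiff_v_segment (h : CompactDualityAssumption F f g) {L : ℝ≥0}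
    (hL : LipschitzWith L (gradient f))
    (hG : ∀ t ∈ Set.Icc (0 : ℝ) 1, IsClosed (aggregates g (segment m₀ m₁ t))) :
    ContinuousOn (fun t => integralDiff (v f g (segment m₀ m₁ t)) m₀ m₁) (Set.Icc 0 1) := by
  obtain ⟨M, hM⟩ := h.bounded_g
  exact (LipschitzOnWith.of_dist_le_mul (K := 8 * L * ⟨M ^ 2, sq_nonneg M⟩) fun t ht s hs =>
    h.abs_integralDiff_v_segment_sub_le hL hM hG hs ht).continuousOn

end CompactDualityAssumption

end Duality

end MFO

theorem mainTheorem6_general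
    {X Y H : Type*} [TopologicalSpace X] [MeasurableSpace X] [OpensMeasurableSpace X]
    [TopologicalSpace Y] [PolishSpace Y] [MeasurableSpace Y] [BorelSpace Y]
    [NormedAddCommGroup H] [InnerProductSpace ℝ H] [CompleteSpace H]
    {F : X → Set Y} {f : H → ℝ} {g : MFO.Graph F → H} {L : ℝ≥0} {P : Set (Measure X)}
    (h : MFO.CompactDualityAssumption F f g) (hL : LipschitzWith L (gradient f))
    (hprob : ∀ m ∈ P, IsProbabilityMeasure m)
    (hseg : ∀ m₀ ∈ P, ∀ m₁ ∈ P, ∀ t ∈ Set.Icc (0 : ℝ) 1, MFO.segment m₀ m₁ t ∈ P)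
    (hG : ∀ m ∈ P, IsClosed (MFO.aggregates g m)) :
    (∀ m ∈ P, IsGLB (MFO.costs f g m) (MFO.V f g m)) ∧
    (∀ m ∈ P, ∃! lam : H, MFO.IsDualSolution f g m lam) ∧
    (∀ m ∈ P, ∀ m' ∈ P, Integrable (MFO.v f g m) m') ∧
    ∀ m₀ ∈ P, ∀ m₁ ∈ P,
      Tendsto (fun t : ℝ => (MFO.V f g (MFO.segment m₀ m₁ t) - MFO.V f g m₀) / t)
        (𝓝[>] 0) (𝓝 (MFO.integralDiff (MFO.v f g m₀) m₀ m₁)) ∧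
      IntervalIntegrable
        (fun t : ℝ => MFO.integralDiff (MFO.v f g (MFO.segment m₀ m₁ t)) m₀ m₁) volume 0 1 ∧
      MFO.V f g m₁ - MFO.V f g m₀ =
        ∫ t in (0 : ℝ)..1, MFO.integralDiff (MFO.v f g (MFO.segment m₀ m₁ t)) m₀ m₁ := by
  refine ⟨fun m hm => have := hprob m hm; h.isGLB_costs (hG m hm),
    fun m hm => have := hprob m hm; h.existsUnique_isDualSolution (hG m hm),
    fun m hm m' hm' => have := hprob m hm; have := hprob m' hm'; h.integrable_v (hG m hm) m',
    fun m₀ hm₀ m₁ hm₁ => ?_⟩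
  have := hprob m₀ hm₀
  have := hprob m₁ hm₁
  have hGseg t (ht : t ∈ Set.Icc (0 : ℝ) 1) : IsClosed (MFO.aggregates g (MFO.segment m₀ m₁ t)) :=
    hG _ (hseg m₀ hm₀ m₁ hm₁ t ht)
  have hcont := h.continuousOn_integralDiff_v_segment hL hGseg
  have hsub s (hs : s ∈ Set.Icc (0 : ℝ) 1) t (ht : t ∈ Set.Icc (0 : ℝ) 1) :=
    h.V_segment_add_le hGseg hs ht
  have hright := MFO.tendsto_slope_nhdsGT_of_subgradient zero_lt_one hsub hcont
  have hintegral := MFO.sub_eq_integral_of_subgradient zero_le_one hsub hcont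
  refine ⟨?_, hcont.intervalIntegrable_of_Icc zero_le_one, ?_⟩
  · simpa only [slope_fun_def_field, MFO.segment_zero, sub_zero] using hright
  · simpa only [MFO.segment_zero, MFO.segment_one] using hintegral

theorem mainTheorem6
    {E : Type*} [NormedAddCommGroup E] [NormedSpace ℝ E] [CompleteSpace E]
    [TopologicalSpace.SeparableSpace E] [MeasurableSpace E] [BorelSpace E]
    (X : Set E) (hX : IsClosed X)
    {Y : Type*} [MetricSpace Y] [CompleteSpace Y] [TopologicalSpace.SeparableSpace Y]
    [MeasurableSpace Y] [BorelSpace Y]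
    {H : Type*} [NormedAddCommGroup H] [InnerProductSpace ℝ H] [CompleteSpace H]
    [TopologicalSpace.SeparableSpace H]
    (F : X → Set Y) (hF_closed : IsClosed (MFO.Graph F)) (hF_nonempty : ∀ x, (F x).Nonempty)
    (f : H → ℝ) (g : MFO.Graph F → H) (L Lg : ℝ≥0)
    (hA : MFO.DualityAssumption f g L) (hB : MFO.StabilityAssumption F g Lg)
    (hG : ∀ m ∈ MFO.P1 X, IsClosed (MFO.aggregates g m)) :
    -- well-posedness of `V`, of `λ*` and of the integrals of `v`
    (∀ m ∈ MFO.P1 X, IsGLB (MFO.costs f g m) (MFO.V f g m)) ∧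
    (∀ m ∈ MFO.P1 X, ∃! lam : H, MFO.IsDualSolution f g m lam) ∧
    (∀ m ∈ MFO.P1 X, ∀ m' ∈ MFO.P1 X, Integrable (MFO.v f g m) m') ∧
    -- the directional derivative and the integral formula
    ∀ m₀ ∈ MFO.P1 X, ∀ m₁ ∈ MFO.P1 X,
      Tendsto (fun t : ℝ => (MFO.V f g (MFO.segment m₀ m₁ t) - MFO.V f g m₀) / t)
        (𝓝[>] 0) (𝓝 (MFO.integralDiff (MFO.v f g m₀) m₀ m₁)) ∧
      IntervalIntegrable
        (fun t : ℝ => MFO.integralDiff (MFO.v f g (MFO.segment m₀ m₁ t)) m₀ m₁) volume 0 1 ∧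
      MFO.V f g m₁ - MFO.V f g m₀ =
        ∫ t in (0 : ℝ)..1, MFO.integralDiff (MFO.v f g (MFO.segment m₀ m₁ t)) m₀ m₁ := by
  have : SecondCountableTopology E := UniformSpace.secondCountable_of_separable E
  have : SecondCountableTopology Y := UniformSpace.secondCountable_of_separable Y
  exact mainTheorem6_general
    ⟨hF_nonempty, hB.compact_fibres, hB.usc_F, hA.bounded_g, hB.continuous_g.stronglyMeasurable,
      hA.convex_f, hA.differentiable_f, hA.lsc_gLam⟩
    hA.lipschitz_gradient (fun _ hm => hm.1)
    (fun _ hm₀ _ hm₁ _ ht => MFO.segment_mem_P1 hm₀ hm₁ ht) hG
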